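/- **Theorem 2.1.** Write $e(\alpha)=\exp(2\pi \mathrm i\alpha)$. For real $X\ge 0$, real $\alpha_1,\alpha_2,\beta_1,\beta_2$, integers $a_1,a_2$ and a natural number $q\ge 1$, put $$f(\alpha_1,\alpha_2)=\sum_{1\le x\le X} e(\alpha_1x+\alpha_2x^2),\qquad S(q,a_1,a_2)=\sum_{x=1}^{q} e\Big(\frac{a_1x+a_2x^2}{q}\Big),\qquad I(\beta_1,\beta_2)=\int_0^X e(\beta_1u+\beta_2u^2)\,\mathrm du,$$ where $x$ runs over integers. There is an absolute constant $C>0$ such that the following holds for all real $X\ge 0$, all $a_1,a_2\in\mathbb Z$, all natural numbers $q\ge 1$ and all $\alpha_1,\alpha_2\in\mathbb R$. Put $\beta_j=\alpha_j-a_j/q$ for $j=1,2$, and suppose that $|\beta_1|\le 1/(2q)$. Then $$\big| f(\alpha_1,\alpha_2)-q^{-1}S(q,a_1,a_2)I(\beta_1,\beta_2)\big|\le C\,(q,a_2)^{1/2}\,(q+qX^2|\beta_2|)^{1/2}\,\log(2q),$$ where $(q,a_2)$ denotes the greatest common divisor. No coprimality of $a_2$ and $q$ is assumed. -/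

import Mathlib

noncomputable section

namespace QuadWeyl

/-- `e(α) = exp(2πiα)`. -/
def e (α : ℝ) : ℂ := Complex.exp (2 * Real.pi * Complex.I * α)

/-- The quadratic Weyl sum `f(α₁, α₂) = ∑ e(α₁ x + α₂ x²)` over the natural numbers
`1 ≤ x ≤ X`, for a real number `X`. -/
def f (X α₁ α₂ : ℝ) : ℂ :=
  ∑ x ∈ Finset.Icc 1 ⌊X⌋₊, e (α₁ * (x : ℝ) + α₂ * (x : ℝ) ^ 2)

/-- The complete quadratic sum `S(q, a₁, a₂) = ∑_{x=1}^q e((a₁ x + a₂ x²) / q)`. -/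
def S (q : ℕ) (a₁ a₂ : ℤ) : ℂ :=
  ∑ x ∈ Finset.Icc 1 q, e (((a₁ : ℝ) * (x : ℝ) + (a₂ : ℝ) * (x : ℝ) ^ 2) / (q : ℝ))

/-- The integral `I(β₁, β₂) = ∫_0^X e(β₁ u + β₂ u²) du`. -/
def I (X β₁ β₂ : ℝ) : ℂ :=
  ∫ u in (0 : ℝ)..X, e (β₁ * u + β₂ * u ^ 2)

end QuadWeyl

end

/-!
The incomplete sum is split into sums without arithmetic content by Fourier inversion modulo `q`:
with `α₂ = a₂ / q + β₂`, the sum over `n < N` is `1 / q` times the sum over `j < q` of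
`S(q, m + j, a₂)` times `∑ e((α₁ - (m + j) / q) n + β₂ n²)`, for any integer `m`
(`quadSum_eq_sum_S_mul`). Every complete sum is `O((q (q, a₂))^{1/2})` (`norm_S_le`), so it remains
to bound the sums of `e(γ n + β₂ n²)`, for `q` values of `γ` equally spaced modulo `1`. Two
estimates do this: the Kusmin-Landau inequality, which gives `1 / δ` when the differences of the
phase stay at distance `δ` from the integers (`norm_quadSum_le_one_div`), and the second derivative
test, which gives `O(|β₂|^{-1/2})` when these differences vary by at most `1 / 4`
(`norm_quadSum_le_div_sqrt`). There are three ranges of `β₂`.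

* If `16 q |β₂| > 1`, the trivial bound `X` suffices for both terms.
* If `16 q |β₂| X ≤ 1`, take `m = a₁`. For `j = 0` the slope of the phase is below `3 / 4`, and the
  sum is `I(β₁, β₂) + O(1)` (`norm_quadSum_sub_I_le`), which is the main term. For `j ≠ 0` the
  differences of the phase are about `-j / q`, and Kusmin-Landau gives `O(q / j + q / (q - j))`;
  summing over `j` produces the logarithm (`norm_quadSum_sub_main_le`).
* Otherwise no cancellation between the two terms is needed. The main term is small because
  `I(β₁, β₂) = O(|β₂|^{-1/2}) = O(q X |β₂|^{1/2})` (`norm_I_le_div_sqrt`). The sum is cut into blocks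
  of length at most `1 / (8 |β₂|)`; in each block the second derivative test is used for the few `j`
  for which the phase is stationary modulo `1`, and Kusmin-Landau for the other ones
  (`norm_quadSum_le_of_short`, `norm_quadSum_le_mul_sqrt`).
-/

open Finset

namespace QuadWeyl

/-! ### The exponential `e` -/

lemma e_eq_exp_I (x : ℝ) : e x = Complex.exp (((2 * Real.pi * x : ℝ) : ℂ) * Complex.I) := by
  unfold e; congr 1; push_cast; ring

lemma norm_e (x : ℝ) : ‖e x‖ = 1 := by
  rw [e_eq_exp_I, Complex.norm_exp_ofReal_mul_I]

lemma e_add (x y : ℝ) : e (x + y) = e x * e y := by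
  unfold e; rw [← Complex.exp_add]; congr 1; push_cast; ring

lemma e_zero : e 0 = 1 := by simp [e]

lemma e_intCast (k : ℤ) : e k = 1 := by
  unfold e
  rw [← Complex.exp_int_mul_two_pi_mul_I k]
  congr 1; push_cast; ring

lemma continuous_e : Continuous e := by unfold e; fun_prop

lemma hasDerivAt_e (x : ℝ) : HasDerivAt e (2 * Real.pi * Complex.I * e x) x := by
  unfold e
  have h : HasDerivAt (fun x : ℝ => 2 * (Real.pi : ℂ) * Complex.I * (x : ℂ))
      (2 * Real.pi * Complex.I) x := by
    simpa using (Complex.ofRealCLM.hasDerivAt (x := x)).const_mul (2 * (Real.pi : ℂ) * Complex.I)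
  simpa [mul_comm] using h.cexp

lemma conj_e (x : ℝ) : (starRingEnd ℂ) (e x) = e (-x) := by
  unfold e; rw [← Complex.exp_conj]; congr 1
  simp [map_ofNat]

lemma norm_e_sub_e_le (x y : ℝ) : ‖e x - e y‖ ≤ 2 * Real.pi * |x - y| := by
  have h : e x - e y = e y * (Complex.exp (Complex.I * ((2 * Real.pi * (x - y) : ℝ) : ℂ)) - 1) := by
    have : e x = e y * e (x - y) := by rw [← e_add]; congr 1; ring
    rw [this, e_eq_exp_I (x - y), mul_comm Complex.I]; ring
  rw [h, norm_mul, norm_e, one_mul]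
  refine Real.norm_exp_I_mul_ofReal_sub_one_le.trans ?_
  rw [Real.norm_eq_abs, abs_mul, abs_of_pos Real.two_pi_pos]

lemma e_sub_one (x : ℝ) : e x - 1 =
    2 * Complex.I * Real.sin (Real.pi * x) * (Real.cos (Real.pi * x)
      + Real.sin (Real.pi * x) * Complex.I) := by
  have h : e x = (Real.cos (Real.pi * x) + Real.sin (Real.pi * x) * Complex.I) ^ 2 := by
    rw [Complex.ofReal_cos, Complex.ofReal_sin, ← Complex.exp_mul_I, ← Complex.exp_nat_mul]
    unfold e; congr 1; push_cast; ring
  have hs : (Real.cos (Real.pi * x) : ℂ) ^ 2 = 1 - (Real.sin (Real.pi * x) : ℂ) ^ 2 := by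
    rw [eq_sub_iff_add_eq]; exact_mod_cast Real.cos_sq_add_sin_sq (Real.pi * x)
  rw [h]
  linear_combination hs - (Real.sin (Real.pi * x) : ℂ) ^ 2 * Complex.I_sq

lemma norm_e_sub_one (x : ℝ) : ‖e x - 1‖ = 2 * |Real.sin (Real.pi * x)| := by
  have : ‖(Real.cos (Real.pi * x) + Real.sin (Real.pi * x) * Complex.I : ℂ)‖ = 1 := by
    rw [Complex.ofReal_cos, Complex.ofReal_sin, ← Complex.exp_mul_I, Complex.norm_exp_ofReal_mul_I]
  rw [e_sub_one, norm_mul, this, norm_mul, norm_mul, Complex.norm_I, Complex.norm_real,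
    Real.norm_eq_abs]
  norm_num

/-! ### Summation by parts and the Kusmin-Landau inequality -/

/-- Summation by parts, for weights `w` of bounded variation. -/
lemma norm_sum_sub_mul_le (z w : ℕ → ℂ) (hz : ∀ n, ‖z n‖ ≤ 1) (N : ℕ) :
    ‖∑ n ∈ range (N + 1), (z (n + 1) - z n) * w n‖ ≤
      ‖w 0‖ + ‖w N‖ + ∑ n ∈ range N, ‖w (n + 1) - w n‖ := by
  have h : ∑ n ∈ range (N + 1), (z (n + 1) - z n) * w n =
      z (N + 1) * w N - z 0 * w 0 - ∑ n ∈ range N, z (n + 1) * (w (n + 1) - w n) := by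
    induction N with
    | zero => simp; ring
    | succ N ih => rw [sum_range_succ, ih, sum_range_succ _ N]; ring
  have hm : ∀ n v, ‖z n * v‖ ≤ ‖v‖ := fun n v => by
    rw [norm_mul]; exact mul_le_of_le_one_left (norm_nonneg _) (hz n)
  rw [h]
  calc _ ≤ ‖z (N + 1) * w N‖ + ‖z 0 * w 0‖ + ‖∑ n ∈ range N, z (n + 1) * (w (n + 1) - w n)‖ :=
        (norm_sub_le _ _).trans (by gcongr; exact norm_sub_le _ _)
    _ ≤ ‖w N‖ + ‖w 0‖ + ∑ n ∈ range N, ‖w (n + 1) - w n‖ := by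
        gcongr
        · exact hm _ _
        · exact hm _ _
        · exact (norm_sum_le _ _).trans (sum_le_sum fun n _ => hm _ _)
    _ = _ := by ring

lemma two_mul_le_sin_pi_mul {δ y : ℝ} (hδ : 0 ≤ δ) (h₁ : δ ≤ y) (h₂ : y ≤ 1 - δ) :
    2 * δ ≤ Real.sin (Real.pi * y) := by
  have key : ∀ t : ℝ, 0 ≤ t → t ≤ 1 / 2 → 2 * t ≤ Real.sin (Real.pi * t) := fun t h0 h1 => by
    have := Real.mul_le_sin (x := Real.pi * t) (by positivity) (by nlinarith [Real.pi_pos])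
    calc 2 * t = 2 / Real.pi * (Real.pi * t) := by field_simp
      _ ≤ _ := this
  rcases le_total y (1 / 2) with h | h
  · exact (by linarith : 2 * δ ≤ 2 * y).trans (key y (hδ.trans h₁) h)
  · have := key (1 - y) (by linarith) (by linarith)
    rw [show Real.pi * (1 - y) = Real.pi - Real.pi * y by ring, Real.sin_pi_sub] at this
    linarith

lemma inv_e_sub_one {y : ℝ} (hs : Real.sin (Real.pi * y) ≠ 0) :
    (e y - 1)⁻¹ = -1 / 2 - Complex.I / 2 *
      ((Real.cos (Real.pi * y) / Real.sin (Real.pi * y) : ℝ) : ℂ) := by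
  have hs' : (Real.sin (Real.pi * y) : ℂ) ≠ 0 := by exact_mod_cast hs
  have h1 : (Real.cos (Real.pi * y) : ℂ) ^ 2 + (Real.sin (Real.pi * y) : ℂ) ^ 2 = 1 := by
    exact_mod_cast Real.cos_sq_add_sin_sq (Real.pi * y)
  refine inv_eq_of_mul_eq_one_right ?_
  rw [e_sub_one]
  rw [Complex.ofReal_div]
  field_simp
  linear_combination h1 - ((Real.cos (Real.pi * y) : ℂ) ^ 2 + (Real.sin (Real.pi * y) : ℂ) ^ 2
    + (Real.cos (Real.pi * y) : ℂ) * Real.sin (Real.pi * y) * Complex.I) * Complex.I_sq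

/-- The Kusmin-Landau inequality: an exponential sum whose phase has increasing differences
staying at distance at least `δ` from the integers is at most `1 / δ`. -/
lemma norm_sum_e_le_of_monotone_differences (F : ℕ → ℝ) (k : ℤ) {δ : ℝ} (hδ : 0 < δ) (N : ℕ)
    (hmono : ∀ n, F (n + 1) - F n ≤ F (n + 2) - F (n + 1))
    (h : ∀ n < N, k + δ ≤ F (n + 1) - F n ∧ F (n + 1) - F n ≤ k + 1 - δ) :
    ‖∑ n ∈ range N, e (F n)‖ ≤ 1 / δ := by
  obtain _ | M := N
  · simp; positivity
  set y : ℕ → ℝ := fun n => F (n + 1) - F n - k with hy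
  set s : ℕ → ℝ := fun n => Real.sin (Real.pi * y n) with hs
  set c : ℕ → ℝ := fun n => Real.cos (Real.pi * y n) / s n with hc
  have hsδ : ∀ n ≤ M, 2 * δ ≤ s n := fun n hn => by
    have := h n (by omega)
    exact two_mul_le_sin_pi_mul hδ.le (by simp only [hy]; linarith) (by simp only [hy]; linarith)
  have hs0 : ∀ n ≤ M, 0 < s n := fun n hn => by linarith [hsδ n hn]
  have hw : ∀ n ≤ M, (e (y n) - 1)⁻¹ = -1 / 2 - Complex.I / 2 * (c n : ℂ) := fun n hn =>
    inv_e_sub_one (hs0 n hn).ne'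
  have hwn : ∀ n ≤ M, ‖(e (y n) - 1)⁻¹‖ ≤ 1 / (4 * δ) := fun n hn => by
    rw [norm_inv, norm_e_sub_one, inv_eq_one_div]
    exact one_div_le_one_div_of_le (by positivity) (by linarith [hsδ n hn, le_abs_self (s n)])
  have hcn : ∀ n ≤ M, |c n| ≤ 1 / (2 * δ) := fun n hn => by
    rw [hc, abs_div, abs_of_pos (hs0 n hn)]
    exact div_le_div₀ zero_le_one (Real.abs_cos_le_one _) (by positivity) (hsδ n hn)
  -- The weights `1 / (e(y) - 1)` are affine in `cot(π y)`, which decreases along the sum, so that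
  -- their total variation telescopes.
  have hcd : ∀ n < M, c (n + 1) ≤ c n := fun n hn => by
    have h1 := hs0 n hn.le
    have h2 := hs0 (n + 1) hn
    have hd : 0 ≤ Real.sin (Real.pi * y (n + 1) - Real.pi * y n) := by
      have h3 := h n (by omega)
      have h4 := h (n + 1) (by omega)
      have h5 := hmono n
      have h6 : 0 ≤ y (n + 1) - y n := by simp only [hy]; linarith
      have h7 : y (n + 1) - y n ≤ 1 := by simp only [hy]; linarith
      rw [← mul_sub]
      exact Real.sin_nonneg_of_nonneg_of_le_pi (by positivity)
        (by nlinarith [Real.pi_pos])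
    rw [Real.sin_sub] at hd
    rw [hc]
    simp only
    rw [div_le_div_iff₀ h2 h1]
    simp only [hs]
    linarith
  have hdiff : ∀ n < M, ‖(e (y (n + 1)) - 1)⁻¹ - (e (y n) - 1)⁻¹‖ = (c n - c (n + 1)) / 2 :=
    fun n hn => by
      rw [hw _ hn, hw _ hn.le, show (-1 / 2 - Complex.I / 2 * (c (n + 1) : ℂ)
        - (-1 / 2 - Complex.I / 2 * (c n : ℂ))) = Complex.I * (((c n - c (n + 1)) / 2 : ℝ) : ℂ) by
          push_cast; ring, norm_mul, Complex.norm_I, one_mul, Complex.norm_real,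
        Real.norm_eq_abs, abs_of_nonneg (by linarith [hcd n hn])]
  have hz : ∀ n ≤ M, e (F n) = (e (F (n + 1)) - e (F n)) * (e (y n) - 1)⁻¹ := fun n hn => by
    have hne : e (y n) - 1 ≠ 0 := by
      rw [← norm_ne_zero_iff, norm_e_sub_one]
      have := hs0 n hn
      positivity
    rw [eq_mul_inv_iff_mul_eq₀ hne, mul_sub, ← e_add, mul_one]
    congr 1
    rw [show F (n + 1) = F n + y n + k by simp only [hy]; ring, e_add _ (k : ℝ), e_intCast, mul_one]
  rw [sum_congr rfl fun n hn => hz n (by simp at hn; omega)]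
  refine (norm_sum_sub_mul_le (fun n => e (F n)) _ (fun n => (norm_e _).le) M).trans ?_
  rw [sum_congr rfl fun n hn => hdiff n (by simpa using hn), ← sum_div, sum_range_sub']
  have h1 := hwn 0 (Nat.zero_le _)
  have h2 := hwn M le_rfl
  have h3 := abs_le.1 (hcn 0 (Nat.zero_le _))
  have h4 := abs_le.1 (hcn M le_rfl)
  have h5 : 1 / (4 * δ) = 1 / δ / 4 := by field_simp
  have h6 : 1 / (2 * δ) = 1 / δ / 2 := by field_simp
  rw [h5] at h1 h2
  rw [h6] at h3 h4
  linarith [h3.1, h3.2, h4.1, h4.2]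

/-! ### Quadratic exponential sums with real coefficients -/

/-- The sum `∑ e(γ n + β n²)` over the integers `0 ≤ n < N`. -/
noncomputable def quadSum (N : ℕ) (γ β : ℝ) : ℂ := ∑ n ∈ range N, e (γ * n + β * (n : ℝ) ^ 2)

lemma norm_quadSum_neg (N : ℕ) (γ β : ℝ) : ‖quadSum N (-γ) (-β)‖ = ‖quadSum N γ β‖ := by
  rw [← RCLike.norm_conj (quadSum N γ β)]
  unfold quadSum
  rw [map_sum]
  congr 1
  refine sum_congr rfl fun n _ => ?_
  rw [conj_e]; congr 1; ring

lemma norm_quadSum_le (N : ℕ) (γ β : ℝ) : ‖quadSum N γ β‖ ≤ N := by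
  unfold quadSum
  refine (norm_sum_le _ _).trans ?_
  simp [norm_e]

lemma quadSum_add (M N : ℕ) (γ β : ℝ) : quadSum (M + N) γ β =
    quadSum M γ β + e (γ * M + β * (M : ℝ) ^ 2) * quadSum N (γ + 2 * β * M) β := by
  unfold quadSum
  rw [sum_range_add, mul_sum]
  congr 1
  refine sum_congr rfl fun n _ => ?_
  rw [← e_add]; congr 1; push_cast; ring

lemma norm_quadSum_add_le (M N : ℕ) (γ β : ℝ) : ‖quadSum (M + N) γ β‖ ≤
    ‖quadSum M γ β‖ + ‖quadSum N (γ + 2 * β * M) β‖ := by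
  rw [quadSum_add]
  refine (norm_add_le _ _).trans_eq ?_
  rw [norm_mul, norm_e, one_mul]

lemma norm_quadSum_le_one_div (N : ℕ) (γ β : ℝ) (k : ℤ) {δ : ℝ} (hδ : 0 < δ)
    (h : ∀ n < N, k + δ ≤ γ + β * (2 * n + 1) ∧ γ + β * (2 * n + 1) ≤ k + 1 - δ) :
    ‖quadSum N γ β‖ ≤ 1 / δ := by
  wlog hβ : 0 ≤ β generalizing γ β k
  · rw [← norm_quadSum_neg]
    refine this (-γ) (-β) (-k - 1) (fun n hn => ?_) (by linarith)
    have := h n hn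
    push_cast
    constructor <;> linarith
  refine norm_sum_e_le_of_monotone_differences (fun n : ℕ => γ * n + β * (n : ℝ) ^ 2) k hδ N
    (fun n => ?_) fun n hn => ?_
  · push_cast; nlinarith
  · have := h n hn
    push_cast
    constructor <;> nlinarith

/-- The second derivative test for a sum short enough that the differences of its phase vary by
at most `1 / 4`. -/
lemma norm_quadSum_le_div_sqrt (N : ℕ) (γ : ℝ) {β : ℝ} (hβ : β ≠ 0) (hβ' : |β| ≤ 1 / 16)
    (hN : N * |β| ≤ 1 / 8) : ‖quadSum N γ β‖ ≤ 4 / √|β| := by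
  wlog hpos : 0 < β generalizing γ β
  · rw [← norm_quadSum_neg, ← abs_neg β]
    rw [← abs_neg β] at hβ' hN
    exact this (-γ) (neg_ne_zero.2 hβ) hβ' hN
      (by rcases lt_or_gt_of_ne hβ with h | h <;> [linarith; exact absurd h hpos])
  rw [abs_of_pos hpos] at *
  set η := √β with hη
  have hη0 : 0 < η := Real.sqrt_pos.2 hpos
  have hηsq : η * η = β := Real.mul_self_sqrt hpos.le
  have hη1 : η ≤ 1 / 4 := by nlinarith
  set k : ℤ := round (γ + β * N) with hk
  have hkd := abs_le.1 (abs_sub_round (γ + β * N))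
  rw [← hk] at hkd
  -- Split at the points where the differences of the phase enter and leave `(k - η, k + η)`.
  set u : ℝ := (k - η - γ - β) / (2 * β) with hu
  set v : ℝ := (k + η - γ - β) / (2 * β) with hv
  have hu' : 2 * β * u = k - η - γ - β := by rw [hu]; field_simp
  have hv' : 2 * β * v = k + η - γ - β := by rw [hv]; field_simp
  have huv : u ≤ v := by
    have : 2 * β * u ≤ 2 * β * v := by linarith
    exact le_of_mul_le_mul_left this (by linarith)
  have hceil : ⌈u⌉₊ ≤ ⌈v⌉₊ := Nat.ceil_mono huv
  set A := min ⌈u⌉₊ N with hA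
  set B := min ⌈v⌉₊ N with hB
  have hAB : A ≤ B := min_le_min_right _ hceil
  have hBN : B ≤ N := min_le_right _ _
  obtain ⟨m, hm⟩ := Nat.exists_eq_add_of_le hAB
  obtain ⟨d, hd⟩ := Nat.exists_eq_add_of_le hBN
  have h1 : ‖quadSum A γ β‖ ≤ 1 / η := by
    refine norm_quadSum_le_one_div A γ β (k - 1) hη0 fun n hn => ?_
    have hn1 : (n : ℝ) < u := Nat.lt_ceil.1 (hn.trans_le (min_le_left _ _))
    have hn2 : 2 * β * n ≤ 2 * β * u := by gcongr
    have hn3 : 0 ≤ 2 * β * n := by positivity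
    push_cast
    constructor <;> linarith
  have h2 : ‖quadSum m (γ + 2 * β * A) β‖ ≤ 1 / η + 1 := by
    refine (norm_quadSum_le _ _ _).trans ?_
    have hmle : (m : ℝ) = B - A := by rw [hm]; push_cast; ring
    rcases lt_or_ge v 0 with hv0 | hv0
    · have : B = 0 := by rw [hB, Nat.ceil_eq_zero.2 hv0.le]; simp
      have : (m : ℝ) = 0 := by exact_mod_cast (by omega : m = 0)
      rw [this]; positivity
    · have hvu : v - u = 1 / η := by
        rw [hv, hu, ← hηsq]; field_simp; ring
      have hle : B + ⌈u⌉₊ ≤ ⌈v⌉₊ + A := by omega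
      have hle' : (B : ℝ) + ⌈u⌉₊ ≤ ⌈v⌉₊ + A := by exact_mod_cast hle
      linarith [Nat.ceil_lt_add_one hv0, Nat.le_ceil u]
  have h3 : ‖quadSum d (γ + 2 * β * B) β‖ ≤ 1 / η := by
    refine norm_quadSum_le_one_div d _ β k hη0 fun n hn => ?_
    have hB' : B = ⌈v⌉₊ := by omega
    have hn1 : v ≤ B := hB' ▸ Nat.le_ceil v
    have hn2 : 2 * β * v ≤ 2 * β * B := by gcongr
    have hn3 : 0 ≤ 2 * β * n := by positivity
    have hn4 : (B : ℝ) + n + 1 ≤ N := by exact_mod_cast (by omega : B + n + 1 ≤ N)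
    have hn5 : β * (B + n + 1) ≤ β * N := by gcongr
    constructor <;> linarith
  have h4 : 1 ≤ 1 / η := by rw [le_div_iff₀ hη0]; linarith
  calc ‖quadSum N γ β‖ ≤ ‖quadSum A γ β‖ + ‖quadSum m (γ + 2 * β * A) β‖
        + ‖quadSum d (γ + 2 * β * B) β‖ := by
        rw [hd]
        refine (norm_quadSum_add_le _ _ _ _).trans ?_
        gcongr
        rw [hm]
        exact norm_quadSum_add_le _ _ _ _
    _ ≤ 1 / η + (1 / η + 1) + 1 / η := by gcongr
    _ ≤ 4 / η := by rw [show 4 / η = 4 * (1 / η) by ring]; linarith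

/-- A bound for all sums of length at most `L` bounds the longer ones block by block. -/
lemma norm_quadSum_le_of_blocks {L : ℕ} (hL : 0 < L) {β B : ℝ}
    (h : ∀ n ≤ L, ∀ γ, ‖quadSum n γ β‖ ≤ B) (N : ℕ) (γ : ℝ) :
    ‖quadSum N γ β‖ ≤ (N / L + 1) * B := by
  have hB : 0 ≤ B := (norm_nonneg _).trans (h 0 (Nat.zero_le _) 0)
  have hblocks : ∀ (m r : ℕ), r ≤ L → ∀ γ, ‖quadSum (m * L + r) γ β‖ ≤ (m + 1) * B := by
    intro m
    induction m with
    | zero => intro r hr γ; simpa using h r hr γ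
    | succ m ih =>
      intro r hr γ
      rw [show (m + 1) * L + r = L + (m * L + r) by ring]
      refine (norm_quadSum_add_le _ _ _ _).trans ?_
      push_cast
      linarith [h L le_rfl γ, ih r hr (γ + 2 * β * L)]
  conv_lhs => rw [← Nat.div_add_mod' N L]
  refine (hblocks _ _ (Nat.mod_lt _ hL).le γ).trans ?_
  gcongr
  exact Nat.cast_div_le

/-! ### Comparison of a quadratic sum of small slope with an integral -/

/-- The mean of `e(y s)` over `0 ≤ s ≤ 1`, that is, the entire function `(e(y) - 1) / (2πiy)`. -/
noncomputable def meanE (y : ℝ) : ℂ := ∫ s in (0 : ℝ)..1, e (y * s)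

lemma intervalIntegrable_e_comp {g : ℝ → ℝ} (hg : Continuous g) (a b : ℝ) :
    IntervalIntegrable (fun s => e (g s)) MeasureTheory.volume a b :=
  (continuous_e.comp hg).intervalIntegrable a b

lemma e_sub_one_eq_mul_meanE (y : ℝ) :
    e y - 1 = 2 * Real.pi * Complex.I * y * meanE y := by
  have hd : ∀ s ∈ Set.uIcc (0 : ℝ) 1, HasDerivAt (fun s : ℝ => e (y * s))
      (2 * Real.pi * Complex.I * y * e (y * s)) s := fun s _ => by
    have h := (hasDerivAt_e (y * s)).scomp s (by simpa using (hasDerivAt_id s).const_mul y :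
      HasDerivAt (fun s : ℝ => y * s) y s)
    rw [Complex.real_smul] at h
    exact h.congr_deriv (by ring)
  have h := intervalIntegral.integral_eq_sub_of_hasDerivAt hd
    (((continuous_e.comp (by fun_prop : Continuous fun s : ℝ => y * s)).const_mul _
      ).intervalIntegrable _ _)
  rw [intervalIntegral.integral_const_mul] at h
  rw [meanE, h]
  simp [e_zero]

lemma norm_meanE_sub_le (y y' : ℝ) : ‖meanE y - meanE y'‖ ≤ 2 * Real.pi * |y - y'| := by
  unfold meanE
  rw [← intervalIntegral.integral_sub (intervalIntegrable_e_comp (by fun_prop) _ _)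
    (intervalIntegrable_e_comp (by fun_prop) _ _)]
  refine (intervalIntegral.norm_integral_le_of_norm_le_const
    (C := 2 * Real.pi * |y - y'|) fun s hs => ?_).trans_eq (by simp)
  rw [Set.uIoc_of_le zero_le_one] at hs
  refine (norm_e_sub_e_le _ _).trans ?_
  rw [← sub_mul, abs_mul, abs_of_pos hs.1]
  gcongr
  exact mul_le_of_le_one_right (abs_nonneg _) hs.2

lemma one_div_five_le_norm_meanE {y : ℝ} (hy : |y| ≤ 3 / 4) : 1 / 5 ≤ ‖meanE y‖ := by
  rcases eq_or_ne y 0 with rfl | h0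
  · simp [meanE, e_zero]; norm_num
  have hpos : 0 < |y| := abs_pos.2 h0
  have h := congr_arg norm (e_sub_one_eq_mul_meanE y)
  rw [norm_e_sub_one] at h
  have hn : ‖(2 * Real.pi * Complex.I * y : ℂ)‖ = 2 * Real.pi * |y| := by
    simp [abs_of_pos Real.pi_pos]
  rw [norm_mul, hn] at h
  have hsin : 2 / 3 * |y| ≤ |Real.sin (Real.pi * y)| := by
    have habs : |Real.sin (Real.pi * y)| = |Real.sin (Real.pi * |y|)| := by
      rcases abs_choice y with h | h <;> rw [h]
      rw [mul_neg, Real.sin_neg, abs_neg]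
    rw [habs]
    refine le_trans ?_ (le_abs_self _)
    rcases le_total |y| (1 / 2) with h1 | h1
    · have := two_mul_le_sin_pi_mul hpos.le le_rfl (by linarith)
      linarith
    · have := two_mul_le_sin_pi_mul (δ := 1 / 4) (by norm_num) (by linarith : 1 / 4 ≤ |y|)
        (by linarith)
      linarith
  have h2 : 2 / 3 * |y| ≤ Real.pi * ‖meanE y‖ * |y| := by linarith
  have h3 := le_of_mul_le_mul_right h2 hpos
  have h4 : Real.pi * ‖meanE y‖ ≤ 3.15 * ‖meanE y‖ := by
    gcongr; exact Real.pi_lt_d2.le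
  linarith

/-- Summation by parts with the weights `1 / meanE`, which are Lipschitz away from the nonzero
integers, bounds the sum of the derivatives of `e(γ x + β x²)` at the integers. -/
lemma norm_sum_deriv_le (N : ℕ) (γ β : ℝ) (h : |γ| + 2 * |β| * N ≤ 3 / 4) :
    ‖∑ n ∈ range N, ((γ + 2 * β * n : ℝ) : ℂ) * e (γ * n + β * (n : ℝ) ^ 2)‖ ≤ 22 := by
  obtain _ | M := N
  · simp
  set y : ℕ → ℝ := fun n => γ + β * (2 * n + 1) with hy
  set z : ℕ → ℂ := fun n => e (γ * n + β * (n : ℝ) ^ 2) with hz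
  set w : ℕ → ℂ := fun n => (2 * Real.pi * Complex.I * meanE (y n))⁻¹ with hw
  have hyn : ∀ n ≤ M, |y n| ≤ 3 / 4 := fun n hn => by
    have h1 : (n : ℝ) ≤ M := by exact_mod_cast hn
    have h2 : |β| * (2 * n + 1) ≤ |β| * (2 * M + 1) := by gcongr
    have h3 := abs_add_le γ (β * (2 * n + 1))
    rw [abs_mul, abs_of_nonneg (by positivity : (0 : ℝ) ≤ 2 * n + 1)] at h3
    push_cast at h
    linarith [abs_nonneg β]
  have hm : ∀ n ≤ M, 1 / 5 ≤ ‖meanE (y n)‖ := fun n hn => one_div_five_le_norm_meanE (hyn n hn)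
  have hm0 : ∀ n ≤ M, meanE (y n) ≠ 0 := fun n hn =>
    norm_pos_iff.1 (by linarith [hm n hn])
  have hn2 : ‖(2 * Real.pi * Complex.I : ℂ)‖ = 2 * Real.pi := by simp [abs_of_pos Real.pi_pos]
  have hwn : ∀ n ≤ M, ‖w n‖ ≤ 1 := fun n hn => by
    rw [hw, norm_inv, norm_mul, hn2]
    exact inv_le_one_of_one_le₀ (by nlinarith [hm n hn, Real.pi_gt_three])
  have hwd : ∀ n < M, ‖w (n + 1) - w n‖ ≤ 50 * |β| := fun n hn => by
    have e1 : w (n + 1) - w n = (meanE (y n) - meanE (y (n + 1))) *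
        ((2 * Real.pi * Complex.I)⁻¹ * ((meanE (y n))⁻¹ * (meanE (y (n + 1)))⁻¹)) := by
      have := hm0 n hn.le
      have := hm0 (n + 1) hn
      simp only [hw]
      field_simp
    have e2 : ∀ n ≤ M, ‖(meanE (y n))⁻¹‖ ≤ 5 := fun n hn => by
      rw [norm_inv]
      exact inv_le_of_inv_le₀ (by norm_num) (by linarith [hm n hn])
    have e3 := norm_meanE_sub_le (y n) (y (n + 1))
    have e4 : |y n - y (n + 1)| = 2 * |β| := by
      rw [show y n - y (n + 1) = -(2 * β) by simp only [hy]; push_cast; ring, abs_neg, abs_mul]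
      norm_num
    rw [e4] at e3
    rw [e1, norm_mul, norm_mul, norm_mul, norm_inv, hn2]
    calc _ ≤ 2 * Real.pi * (2 * |β|) * ((2 * Real.pi)⁻¹ * (5 * 5)) := by
          gcongr
          · exact e2 n hn.le
          · exact e2 (n + 1) hn
      _ = 50 * |β| := by field_simp; norm_num; ring
  have hterm : ∀ n ≤ M, ((γ + 2 * β * n : ℝ) : ℂ) * z n =
      (z (n + 1) - z n) * w n - (β : ℂ) * z n := fun n hn => by
    have e1 : z (n + 1) = z n * e (y n) := by
      simp only [hz, hy]; rw [← e_add]; congr 1; push_cast; ring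
    have e2 : (z (n + 1) - z n) * w n = z n * y n := by
      rw [e1, show z n * e (y n) - z n = z n * (e (y n) - 1) by ring, e_sub_one_eq_mul_meanE]
      have := hm0 n hn
      simp only [hw]
      field_simp
    rw [e2]
    simp only [hy]
    push_cast
    ring
  have hβ : |β| * (M + 1) ≤ 3 / 8 := by
    push_cast at h
    linarith [abs_nonneg γ]
  rw [sum_congr rfl fun n hn => hterm n (by simp at hn; omega), sum_sub_distrib]
  calc _ ≤ ‖∑ n ∈ range (M + 1), (z (n + 1) - z n) * w n‖
        + ‖∑ n ∈ range (M + 1), (β : ℂ) * z n‖ := norm_sub_le _ _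
    _ ≤ (‖w 0‖ + ‖w M‖ + ∑ n ∈ range M, ‖w (n + 1) - w n‖)
        + ∑ n ∈ range (M + 1), ‖(β : ℂ) * z n‖ := by
        gcongr
        · exact norm_sum_sub_mul_le z w (fun n => (norm_e _).le) M
        · exact norm_sum_le _ _
    _ ≤ (1 + 1 + ∑ n ∈ range M, 50 * |β|) + ∑ n ∈ range (M + 1), |β| := by
        gcongr with n hn n hn
        · exact hwn 0 (Nat.zero_le _)
        · exact hwn M le_rfl
        · exact hwd n (by simpa using hn)
        · simp [hz, norm_e]
    _ = 2 + 50 * (|β| * M) + |β| * (M + 1) := by simp; ring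
    _ ≤ 22 := by linarith [abs_nonneg β]

/-- While the slope of the phase stays below `3 / 4` the sum is an integral up to a bounded error.
The integral is the mean over `0 ≤ t ≤ 1` of the sums over the translates `ℕ + t`, and the
derivative in `t` of these sums is bounded. -/
lemma norm_quadSum_sub_I_le (N : ℕ) (γ β : ℝ) (h : |γ| + 2 * |β| * (N + 1) ≤ 3 / 4) :
    ‖quadSum N γ β - I N γ β‖ ≤ 140 := by
  set A : ℝ → ℂ := fun t => ∑ n ∈ range N, e (γ * (n + t) + β * (n + t) ^ 2) with hA
  have hcont : Continuous A := by
    rw [hA]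
    exact continuous_finsetSum _ fun n _ => continuous_e.comp (by fun_prop)
  have hI : I N γ β = ∫ t in (0 : ℝ)..1, A t := by
    rw [hA, intervalIntegral.integral_finsetSum fun n _ =>
      intervalIntegrable_e_comp (by fun_prop) _ _]
    have h1 := intervalIntegral.sum_integral_adjacent_intervals (n := N)
      (a := fun k : ℕ => (k : ℝ)) (f := fun u => e (γ * u + β * u ^ 2))
      (μ := MeasureTheory.volume) (fun k _ => intervalIntegrable_e_comp (by fun_prop) _ _)
    rw [I]
    rw [Nat.cast_zero] at h1
    rw [← h1]
    refine sum_congr rfl fun n _ => ?_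
    have h2 := intervalIntegral.integral_comp_add_left (a := 0) (b := 1)
      (fun u => e (γ * u + β * u ^ 2)) (n : ℝ)
    rw [h2]
    simp
  have hderiv : ∀ t, HasDerivAt A (2 * Real.pi * Complex.I * ∑ n ∈ range N,
      ((γ + 2 * β * (n + t) : ℝ) : ℂ) * e (γ * (n + t) + β * (n + t) ^ 2)) t := fun t => by
    rw [mul_sum]
    refine HasDerivAt.fun_sum fun n _ => ?_
    have h1 : HasDerivAt (fun t : ℝ => γ * (n + t) + β * (n + t) ^ 2)
        (γ + 2 * β * (n + t)) t := by
      have h2 : HasDerivAt (fun t : ℝ => (n : ℝ) + t) 1 t := (hasDerivAt_id t).const_add _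
      refine ((h2.const_mul γ).add ((h2.pow 2).const_mul β)).congr_deriv ?_
      simp; ring
    have h3 := (hasDerivAt_e _).scomp t h1
    rw [Complex.real_smul] at h3
    exact h3.congr_deriv (by ring)
  have hbound : ∀ t ∈ Set.Icc (0 : ℝ) 1, ‖2 * Real.pi * Complex.I * ∑ n ∈ range N,
      ((γ + 2 * β * (n + t) : ℝ) : ℂ) * e (γ * (n + t) + β * (n + t) ^ 2)‖ ≤ 140 := by
    intro t ht
    have h1 : ∑ n ∈ range N, ((γ + 2 * β * (n + t) : ℝ) : ℂ) * e (γ * (n + t) + β * (n + t) ^ 2) =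
        e (γ * t + β * t ^ 2) * ∑ n ∈ range N, ((γ + 2 * β * t + 2 * β * n : ℝ) : ℂ) *
          e ((γ + 2 * β * t) * n + β * (n : ℝ) ^ 2) := by
      rw [mul_sum]
      refine sum_congr rfl fun n _ => ?_
      rw [mul_left_comm, ← e_add]
      congr 2 <;> ring_nf
    have h2 : |γ + 2 * β * t| + 2 * |β| * N ≤ 3 / 4 := by
      have h3 := abs_add_le γ (2 * β * t)
      rw [abs_mul, abs_mul, abs_of_nonneg ht.1, abs_two] at h3
      have h4 : 2 * |β| * t ≤ 2 * |β| * 1 := by gcongr; exact ht.2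
      linarith
    have h5 := norm_sum_deriv_le N _ β h2
    rw [h1, norm_mul, show ‖(2 * Real.pi * Complex.I : ℂ)‖ = 2 * Real.pi by
      simp [abs_of_pos Real.pi_pos], norm_mul, norm_e, one_mul]
    calc 2 * Real.pi * _ ≤ 2 * 3.15 * 22 := by
          gcongr
          exact Real.pi_lt_d2.le
      _ ≤ 140 := by norm_num
  have hdiff : ∀ t ∈ Set.Icc (0 : ℝ) 1, ‖A 0 - A t‖ ≤ 140 := fun t ht => by
    have h1 := (convex_Icc (0 : ℝ) 1).norm_image_sub_le_of_norm_hasDerivWithin_le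
      (fun x _ => (hderiv x).hasDerivWithinAt) hbound ht (Set.left_mem_Icc.2 zero_le_one)
    refine h1.trans ?_
    rw [zero_sub, norm_neg, Real.norm_eq_abs, abs_of_nonneg ht.1]
    linarith [ht.2]
  have hA0 : quadSum N γ β = ∫ t in (0 : ℝ)..1, A 0 := by simp [hA, quadSum]
  rw [hI, hA0, ← intervalIntegral.integral_sub (by simp) (hcont.intervalIntegrable _ _)]
  refine (intervalIntegral.norm_integral_le_of_norm_le_const
    (C := 140) fun s hs => ?_).trans_eq (by simp)
  rw [Set.uIoc_of_le zero_le_one] at hs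
  exact hdiff s ⟨hs.1.le, hs.2⟩

lemma norm_I_le {X : ℝ} (hX : 0 ≤ X) (γ β : ℝ) : ‖I X γ β‖ ≤ X := by
  refine (intervalIntegral.norm_integral_le_of_norm_le_const (C := 1)
    fun s _ => (norm_e _).le).trans_eq ?_
  rw [sub_zero, abs_of_nonneg hX, one_mul]

lemma I_mul_right (h X γ β : ℝ) : I (h * X) γ β = h * I X (γ * h) (β * h ^ 2) := by
  have := intervalIntegral.smul_integral_comp_mul_left (a := 0) (b := X)
    (fun u => e (γ * u + β * u ^ 2)) h
  rw [mul_zero, Complex.real_smul] at this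
  rw [I, I, ← this]
  congr 2
  funext u
  congr 1; ring

/-- The second derivative test for the integral, obtained from that for sums by approximating
the integral by Riemann sums. -/
lemma norm_I_le_div_sqrt {X : ℝ} (hX : 0 ≤ X) (γ : ℝ) {β : ℝ} (hβ : β ≠ 0) :
    ‖I X γ β‖ ≤ 5 / √|β| := by
  rcases hX.eq_or_lt with rfl | hX
  · simp only [I, intervalIntegral.integral_same, norm_zero]; positivity
  have hβ0 : 0 < |β| := abs_pos.2 hβ
  have hs0 : 0 < √|β| := Real.sqrt_pos.2 hβ0
  -- The constant `K` collects what the step `h = X / M` has to satisfy: `h K ≤ 1` gives the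
  -- hypotheses of both estimates for sums of length `M`, and makes the error `140 h` at most `1 / √|β|`.
  set K := 1 + 16 * (|γ| + 4 * |β| * X + |β|) + 140 * √|β| with hK
  obtain ⟨M, hM⟩ := exists_nat_gt (max 1 (X * K))
  have hM1 : 1 < (M : ℝ) := (le_max_left _ _).trans_lt hM
  have hMK : X * K < M := (le_max_right _ _).trans_lt hM
  set h := X / M with hh
  have hM0 : 0 < (M : ℝ) := by linarith
  have hh0 : 0 < h := by positivity
  have hhM : h * M = X := by rw [hh]; field_simp
  have hhK : h * K ≤ 1 := by
    rw [hh, div_mul_eq_mul_div, div_le_one hM0]; exact hMK.le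
  have hexp : h * K = h + 16 * (|γ| * h + 4 * (|β| * X * h) + |β| * h) + 140 * (h * √|β|) := by
    rw [hK]; ring
  have p1 : 0 ≤ |γ| * h := by positivity
  have p2 : 0 ≤ |β| * X * h := by positivity
  have p3 : 0 ≤ |β| * h := by positivity
  have p4 : 0 ≤ h * √|β| := by positivity
  have hh1 : h ≤ 1 := by linarith
  have hβh : |β * h ^ 2| = |β| * h * h := by
    rw [abs_mul, abs_of_pos (by positivity : 0 < h ^ 2)]; ring
  have hβh1 : |β| * h * h ≤ |β| * h := mul_le_of_le_one_right p3 hh1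
  have hβM : |β| * h * h * M = |β| * X * h := by rw [← hhM]; ring
  have h1 := norm_quadSum_sub_I_le M (γ * h) (β * h ^ 2) (by
    rw [hβh, abs_mul, abs_of_pos hh0]
    linarith)
  have h2 := norm_quadSum_le_div_sqrt M (γ * h) (β := β * h ^ 2) (by positivity)
    (by rw [hβh]; linarith) (by rw [hβh]; linarith)
  have h3 : √|β * h ^ 2| = √|β| * h := by
    rw [abs_mul, abs_of_pos (by positivity : 0 < h ^ 2), Real.sqrt_mul (abs_nonneg _),
      Real.sqrt_sq hh0.le]
  rw [h3] at h2
  have h4 : ‖I M (γ * h) (β * h ^ 2)‖ ≤ 4 / (√|β| * h) + 140 := by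
    have := norm_sub_norm_le (I M (γ * h) (β * h ^ 2)) (quadSum M (γ * h) (β * h ^ 2))
    rw [norm_sub_rev] at this
    linarith
  rw [← hhM, I_mul_right, norm_mul, Complex.norm_real, Real.norm_eq_abs, abs_of_pos hh0]
  calc _ ≤ h * (4 / (√|β| * h) + 140) := by gcongr
    _ = (4 + 140 * (h * √|β|)) / √|β| := by field_simp
    _ ≤ 5 / √|β| := by gcongr; linarith

/-! ### Complete sums modulo `q` -/

section Complete

variable {q : ℕ} [NeZero q]

lemma e_intCast_div (j : ℤ) : e ((j : ℝ) / q) = ZMod.stdAddChar (j : ZMod q) := by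
  rw [ZMod.stdAddChar_coe, e]
  congr 1; push_cast; ring

lemma sum_range_intCast_add {M : Type*} [AddCommMonoid M] (g : ZMod q → M) (m : ℤ) :
    ∑ j ∈ range q, g ((m + j : ℤ) : ZMod q) = ∑ y, g y := by
  rw [← Equiv.sum_comp (Equiv.addLeft (m : ZMod q)) g]
  refine sum_nbij' (fun j => (j : ZMod q)) ZMod.val (by simp) (fun y _ => ?_) (fun j hj => ?_)
    (by simp) (by simp)
  · simpa using ZMod.val_lt y
  · exact ZMod.val_cast_of_lt (by simpa using hj)

lemma S_eq_sum_zmod (a₁ a₂ : ℤ) :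
    S q a₁ a₂ = ∑ x : ZMod q, ZMod.stdAddChar ((a₁ : ZMod q) * x + (a₂ : ZMod q) * x ^ 2) := by
  have hIcc : Icc 1 q = Ico 1 (q + 1) := by ext; simp
  rw [← sum_range_intCast_add _ 1, S, hIcc, sum_Ico_eq_sum_range, Nat.add_sub_cancel]
  refine sum_congr rfl fun j _ => ?_
  have h := e_intCast_div (q := q) (a₁ * (1 + j) + a₂ * (1 + j) ^ 2)
  push_cast at h ⊢
  exact h

lemma conj_stdAddChar (x : ZMod q) :
    (starRingEnd ℂ) (ZMod.stdAddChar x) = ZMod.stdAddChar (-x) := by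
  rw [AddChar.map_neg_eq_conj]

/-- Elements of `ZMod q` killed by `2 b` are killed by `2 (q, b)`, and a cyclic group has at most
that many of them. -/
lemma card_filter_two_mul_eq_zero_le (b : ℤ) :
    #{h : ZMod q | 2 * (b : ZMod q) * h = 0} ≤ 2 * Int.gcd q b := by
  have hpos : 0 < 2 * Int.gcd q b := by
    have : Int.gcd q b ≠ 0 := by
      rw [Ne, Int.gcd_eq_zero_iff]
      have := NeZero.ne q
      omega
    omega
  refine (card_le_card fun h hh => ?_).trans (IsAddCyclic.card_nsmul_eq_zero_le hpos)
  simp only [mem_filter, mem_univ, true_and] at hh ⊢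
  have hg : ((Int.gcd q b : ℤ) : ZMod q) = (b : ZMod q) * (Int.gcdB q b : ℤ) := by
    rw [Int.gcd_eq_gcd_ab]; simp
  rw [nsmul_eq_mul]
  push_cast at hg ⊢
  rw [hg]
  linear_combination (Int.gcdB q b : ZMod q) * hh

/-- The bound for quadratic Gauss sums, without coprimality: in `|S|²` the sum over the difference
of the two variables is a complete linear sum. -/
lemma norm_S_sq_le (a₁ a₂ : ℤ) : ‖S q a₁ a₂‖ ^ 2 ≤ 2 * q * Int.gcd q a₂ := by
  set ψ : AddChar (ZMod q) ℂ := ZMod.stdAddChar with hψ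
  have hnorm : ∀ x, ‖ψ x‖ = 1 := fun x => AddChar.norm_apply ψ x
  have key : S q a₁ a₂ * (starRingEnd ℂ) (S q a₁ a₂) =
      ∑ h : ZMod q, ψ (a₁ * h + a₂ * h ^ 2) *
        (if 2 * (a₂ : ZMod q) * h = 0 then (q : ℂ) else 0) := by
    rw [S_eq_sum_zmod, map_sum, sum_mul_sum, sum_comm]
    calc _ = ∑ y : ZMod q, ∑ h : ZMod q, ψ (a₁ * h + a₂ * h ^ 2) * ψ (y * (2 * a₂ * h)) := by
          refine sum_congr rfl fun y _ => ?_
          rw [← Equiv.sum_comp (Equiv.addLeft y)]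
          refine sum_congr rfl fun h _ => ?_
          rw [conj_stdAddChar, ← hψ, ← AddChar.map_add_eq_mul, ← AddChar.map_add_eq_mul]
          congr 1
          simp only [Equiv.coe_addLeft]
          ring
      _ = _ := by
          rw [sum_comm]
          refine sum_congr rfl fun h _ => ?_
          rw [← mul_sum, AddChar.sum_mulShift _ (ZMod.isPrimitive_stdAddChar q), ZMod.card]
          split_ifs <;> simp
  rw [← RCLike.norm_conj (S q a₁ a₂), sq]
  nth_rw 1 [RCLike.norm_conj]
  rw [← norm_mul, key]
  calc _ ≤ ∑ h : ZMod q, if 2 * (a₂ : ZMod q) * h = 0 then (q : ℝ) else 0 := by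
        refine (norm_sum_le _ _).trans (sum_le_sum fun h _ => ?_)
        rw [norm_mul, hnorm, one_mul]
        split_ifs <;> simp
    _ = #{h : ZMod q | 2 * (a₂ : ZMod q) * h = 0} * (q : ℝ) := by
        rw [← sum_filter, sum_const, nsmul_eq_mul]
    _ ≤ ((2 * Int.gcd q a₂ : ℕ) : ℝ) * q := by
        gcongr
        exact card_filter_two_mul_eq_zero_le a₂
    _ = _ := by push_cast; ring

lemma norm_S_le_sqrt (a₁ a₂ : ℤ) : ‖S q a₁ a₂‖ ≤ √(2 * q * Int.gcd q a₂) :=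
  Real.le_sqrt_of_sq_le (norm_S_sq_le a₁ a₂)

/-- Fourier inversion modulo `q`: the sum with quadratic coefficient `a₂ / q + β` is a combination
of sums with quadratic coefficient `β`. -/
lemma quadSum_eq_sum_S_mul (N : ℕ) (α₁ β : ℝ) (a₂ m : ℤ) :
    quadSum N α₁ (a₂ / q + β) = (q : ℂ)⁻¹ * ∑ j ∈ range q,
      S q (m + j) a₂ * quadSum N (α₁ - ((m + j : ℤ) : ℝ) / q) β := by
  set ψ : AddChar (ZMod q) ℂ := ZMod.stdAddChar with hψ
  have hq : (q : ℂ) ≠ 0 := by exact_mod_cast NeZero.ne q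
  have key : ∀ n : ℕ, ∑ j ∈ range q, S q (m + j) a₂ * e (-(((m + j : ℤ) : ℝ) * n / q)) =
      q * e ((a₂ : ℝ) * (n : ℝ) ^ 2 / q) := by
    intro n
    have h1 : ∀ j ∈ range q, S q (m + j) a₂ * e (-(((m + j : ℤ) : ℝ) * n / q)) =
        ∑ x : ZMod q, ψ (((m + j : ℤ) : ZMod q) * (x - n)) * ψ (a₂ * x ^ 2) := fun j _ => by
      have h2 := e_intCast_div (q := q) (-((m + j) * n))
      rw [show -(((m + j : ℤ) : ℝ) * n / q) = ((-((m + j) * n) : ℤ) : ℝ) / q by push_cast; ring,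
        h2, S_eq_sum_zmod, sum_mul]
      refine sum_congr rfl fun x _ => ?_
      rw [← AddChar.map_add_eq_mul, ← AddChar.map_add_eq_mul]
      congr 1; push_cast; ring
    rw [sum_congr rfl h1, sum_range_intCast_add
      (fun y : ZMod q => ∑ x : ZMod q, ψ (y * (x - n)) * ψ (a₂ * x ^ 2)), sum_comm]
    have h5 : ∀ x : ZMod q, ∑ y : ZMod q, ψ (y * (x - n)) * ψ (a₂ * x ^ 2) =
        if x = n then (q : ℂ) * ψ (a₂ * x ^ 2) else 0 := fun x => by
      rw [← sum_mul, AddChar.sum_mulShift _ (ZMod.isPrimitive_stdAddChar q), ZMod.card]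
      simp only [sub_eq_zero]
      split_ifs <;> simp
    rw [sum_congr rfl fun x _ => h5 x, sum_ite_eq' univ (n : ZMod q)]
    have h3 := e_intCast_div (q := q) (a₂ * n ^ 2)
    push_cast at h3
    rw [h3]
    simp [hψ]
  unfold quadSum
  simp_rw [mul_sum]
  rw [sum_comm]
  refine sum_congr rfl fun n _ => ?_
  have h4 : ∀ j ∈ range q, (q : ℂ)⁻¹ * (S q (m + j) a₂ *
      e ((α₁ - ((m + j : ℤ) : ℝ) / q) * n + β * (n : ℝ) ^ 2)) = (q : ℂ)⁻¹ *
        e (α₁ * n + β * (n : ℝ) ^ 2) * (S q (m + j) a₂ * e (-(((m + j : ℤ) : ℝ) * n / q))) := by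
    intro j _
    rw [show (α₁ - ((m + j : ℤ) : ℝ) / q) * n + β * (n : ℝ) ^ 2 =
      (α₁ * n + β * (n : ℝ) ^ 2) + -(((m + j : ℤ) : ℝ) * n / q) by ring, e_add]
    ring
  rw [sum_congr rfl h4, ← mul_sum, key, mul_comm (q : ℂ)⁻¹, mul_assoc, inv_mul_cancel_left₀ hq,
    ← e_add]
  congr 1; ring

end Complete

/-! ### Upper bounds for incomplete sums near a rational quadratic coefficient -/

lemma sum_range_inv_sub_le (q : ℕ) :
    ∑ j ∈ range q, ((q : ℝ) - j)⁻¹ ≤ 1 + Real.log q := by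
  have h := harmonic_le_one_add_log q
  rw [harmonic] at h
  push_cast at h
  rw [← sum_range_reflect] at h
  refine le_trans (le_of_eq (sum_congr rfl fun j hj => ?_)) h
  congr 1
  have : q - 1 - j + 1 + j = q := by have := mem_range.1 hj; omega
  have : ((q - 1 - j : ℕ) : ℝ) + 1 + j = q := by exact_mod_cast this
  linarith

lemma sum_range_inv_le (q : ℕ) : ∑ j ∈ range q, (j : ℝ)⁻¹ ≤ 1 + Real.log q := by
  obtain _ | p := q
  · simp
  have h := harmonic_le_one_add_log (p + 1)
  rw [harmonic, sum_range_succ] at h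
  push_cast at h
  rw [sum_range_succ']
  push_cast
  have : (0 : ℝ) ≤ ((p : ℝ) + 1)⁻¹ := by positivity
  simp only [inv_zero, add_zero]
  linarith

lemma card_filter_range_lt_le (q : ℕ) {y : ℝ} (hy : 0 ≤ y) :
    (#{j ∈ range q | ((j : ℕ) : ℝ) < y} : ℝ) ≤ y + 1 := by
  have h : #{j ∈ range q | ((j : ℕ) : ℝ) < y} ≤ ⌈y⌉₊ := by
    rw [← card_range ⌈y⌉₊]
    exact card_le_card fun j hj => by
      simp only [mem_filter, mem_range] at hj ⊢
      exact Nat.lt_ceil.2 hj.2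
  exact (by exact_mod_cast h : (_ : ℝ) ≤ (⌈y⌉₊ : ℝ)).trans (Nat.ceil_lt_add_one hy).le

lemma card_filter_range_sub_lt_le (q : ℕ) {y : ℝ} (hy : 0 ≤ y) :
    (#{j ∈ range q | (q : ℝ) - (j : ℕ) < y} : ℝ) ≤ y + 1 := by
  have h : #{j ∈ range q | (q : ℝ) - (j : ℕ) < y} ≤ ⌈y⌉₊ := by
    rw [← card_range ⌈y⌉₊]
    refine card_le_card_of_injOn (fun j => q - j) (fun j hj => ?_) (fun i hi j hj hij => ?_)
    · simp only [coe_filter, mem_range, Set.mem_ofPred_eq] at hj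
      simp only [coe_range, Set.mem_Iio]
      rw [Nat.lt_ceil, Nat.cast_sub hj.1.le]
      exact hj.2
    · simp only [coe_filter, mem_range, Set.mem_ofPred_eq] at hi hj
      simp only at hij
      omega
  exact (by exact_mod_cast h : (_ : ℝ) ≤ (⌈y⌉₊ : ℝ)).trans (Nat.ceil_lt_add_one hy).le

lemma one_div_min_div_le {a b c : ℝ} (ha : 0 < a) (hb : 0 < b) (hc : 0 ≤ c) :
    1 / (min a b / c) ≤ c * (a⁻¹ + b⁻¹) := by
  rw [one_div_div, div_eq_mul_inv]
  gcongr
  have := inv_pos.2 ha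
  have := inv_pos.2 hb
  rcases min_choice a b with h | h <;> rw [h] <;> linarith

lemma norm_S_le {q : ℕ} (hq : 1 ≤ q) (a₁ a₂ : ℤ) :
    ‖S q a₁ a₂‖ ≤ 2 * √(Int.gcd q a₂) * √q := by
  have : NeZero q := ⟨by omega⟩
  refine (norm_S_le_sqrt a₁ a₂).trans (Real.sqrt_le_iff.2 ⟨by positivity, ?_⟩)
  rw [mul_pow, mul_pow, Real.sq_sqrt (by positivity), Real.sq_sqrt (by positivity)]
  nlinarith [(by positivity : (0 : ℝ) ≤ q * (Int.gcd q a₂ : ℝ))]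

lemma norm_inv_mul_le {q : ℕ} (hq : 1 ≤ q) {s Z : ℂ} {A B : ℝ}
    (h : ‖Z‖ ≤ A * (q * B)) (hs : s = (q : ℂ)⁻¹ * Z) : ‖s‖ ≤ A * B := by
  have hq0 : (0 : ℝ) < q := by exact_mod_cast hq
  rw [hs, norm_mul, norm_inv, Complex.norm_natCast]
  calc (q : ℝ)⁻¹ * ‖Z‖ ≤ (q : ℝ)⁻¹ * (A * (q * B)) := by gcongr
    _ = A * B := by field_simp

/-- A sum so short that `β` times its length is at most `1 / 8`. After Fourier inversion modulo
`q` the differences of the phase of the `j`-th sum fill an arc of length `2 N |β|` which rotates by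
`1 / q` with `j`. The second derivative test is applied to the `O(q N |β| + 1)` indices for which
this arc comes near an integer, the Kusmin-Landau inequality to the others. -/
lemma norm_quadSum_le_of_short {q : ℕ} (hq : 1 ≤ q) (N : ℕ) (α₁ : ℝ) (a₂ : ℤ) {β : ℝ}
    (hβ : β ≠ 0) (hβ' : |β| ≤ 1 / 16) (hN : N * |β| ≤ 1 / 8) :
    ‖quadSum N α₁ (a₂ / q + β)‖ ≤ 2 * √(Int.gcd q a₂) * √q *
      (6 * (1 + Real.log q) + (4 * (N * |β|) + 4 / q) * (4 / √|β|)) := by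
  have : NeZero q := ⟨by omega⟩
  have hq0 : (0 : ℝ) < q := by exact_mod_cast hq
  set ρ := N * |β| with hρ
  have hρ0 : 0 ≤ ρ := by positivity
  set B := 4 / √|β| with hB
  have hB0 : 0 ≤ B := by positivity
  -- With this `m`, the arc of the `j`-th sum is centred at a point of `[-j / q, (1 - j) / q)`.
  set m : ℤ := ⌊q * (α₁ + β * N)⌋ with hm
  have hm1 : (m : ℝ) ≤ q * (α₁ + β * N) := Int.floor_le _
  have hm2 : q * (α₁ + β * N) < m + 1 := Int.lt_floor_add_one _
  have hT : ∀ j ∈ range q, ‖quadSum N (α₁ - ((m + j : ℤ) : ℝ) / q) β‖ ≤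
      2 * q * (2 * (j : ℝ)⁻¹ + ((q : ℝ) - j)⁻¹) + (if (j : ℝ) < 2 * q * ρ + 2 then B else 0)
        + (if (q : ℝ) - j < 2 * q * ρ then B else 0) := by
    intro j hj
    have hjq : (j : ℝ) + 1 ≤ q := by exact_mod_cast mem_range.1 hj
    have hqj : 0 < (q : ℝ) - j := by linarith
    have hpos : 0 ≤ 2 * q * (2 * (j : ℝ)⁻¹ + ((q : ℝ) - j)⁻¹) := by positivity
    have hB' := norm_quadSum_le_div_sqrt N (α₁ - ((m + j : ℤ) : ℝ) / q) hβ hβ' hN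
    rw [← hB] at hB'
    by_cases h1 : (j : ℝ) < 2 * q * ρ + 2
    · rw [if_pos h1]
      split_ifs <;> linarith
    by_cases h2 : (q : ℝ) - j < 2 * q * ρ
    · rw [if_pos h2, if_neg h1]
      linarith
    rw [if_neg h1, if_neg h2, add_zero, add_zero]
    push Not at h1 h2
    have hqρ : 0 ≤ q * ρ := by positivity
    have hj1 : 0 < (j : ℝ) - 1 := by linarith
    set μ := min ((j : ℝ) - 1) ((q : ℝ) - j) with hμ
    have hμ0 : 0 < μ := lt_min hj1 hqj
    have hμ1 : μ ≤ j - 1 := min_le_left _ _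
    have hμ2 : μ ≤ q - j := min_le_right _ _
    refine (norm_quadSum_le_one_div N _ β (-1) (δ := μ / (2 * q)) (by positivity)
      fun n hn => ?_).trans ((one_div_min_div_le hj1 hqj (by positivity)).trans ?_)
    · have hn1 : (n : ℝ) + 1 ≤ N := by exact_mod_cast hn
      have hd : |β * (2 * n + 1 - N)| ≤ ρ := by
        rw [abs_mul, hρ, mul_comm]
        gcongr
        exact abs_le.2 ⟨by linarith [(Nat.cast_nonneg n : (0 : ℝ) ≤ n)], by linarith⟩
      obtain ⟨hd1, hd2⟩ := abs_le.1 hd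
      have hd3 := mul_le_mul_of_nonneg_left hd1 hq0.le
      have hd4 := mul_le_mul_of_nonneg_left hd2 hq0.le
      have hq2 : μ / (2 * q) = μ / 2 / q := by field_simp
      have hform : α₁ - ((m + j : ℤ) : ℝ) / q + β * (2 * n + 1) =
          (q * (α₁ + β * N) - m - j + q * (β * (2 * n + 1 - N))) / q := by
        push_cast; field_simp; ring
      rw [hform, hq2]
      push_cast
      constructor
      · rw [← sub_nonneg, show ∀ x : ℝ, x / q - (-1 + μ / 2 / q) = (x + q - μ / 2) / q by
          intro x; field_simp; ring]
        refine div_nonneg ?_ hq0.le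
        linarith
      · rw [← sub_nonneg, show ∀ x : ℝ, (-1 + 1 - μ / 2 / q) - x / q = (- μ / 2 - x) / q by
          intro x; field_simp; ring]
        refine div_nonneg ?_ hq0.le
        linarith
    · gcongr
      rw [← div_eq_mul_inv, inv_eq_one_div, div_le_div_iff₀ hj1 (by linarith)]
      linarith
  refine norm_inv_mul_le hq ?_ (quadSum_eq_sum_S_mul N α₁ β a₂ m)
  calc _ ≤ ∑ j ∈ range q, ‖S q (m + j) a₂ * quadSum N (α₁ - ((m + j : ℤ) : ℝ) / q) β‖ :=
        norm_sum_le _ _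
    _ ≤ ∑ j ∈ range q, 2 * √(Int.gcd q a₂) * √q *
        (2 * q * (2 * (j : ℝ)⁻¹ + ((q : ℝ) - j)⁻¹) + (if (j : ℝ) < 2 * q * ρ + 2 then B else 0)
          + (if (q : ℝ) - j < 2 * q * ρ then B else 0)) := by
        refine sum_le_sum fun j hj => ?_
        rw [norm_mul]
        exact mul_le_mul (norm_S_le hq _ _) (hT j hj) (norm_nonneg _) (by positivity)
    _ = 2 * √(Int.gcd q a₂) * √q *
        (2 * q * (2 * ∑ j ∈ range q, (j : ℝ)⁻¹ + ∑ j ∈ range q, ((q : ℝ) - j)⁻¹)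
          + #{j ∈ range q | ((j : ℕ) : ℝ) < 2 * q * ρ + 2} * B
          + #{j ∈ range q | (q : ℝ) - (j : ℕ) < 2 * q * ρ} * B) := by
        rw [← mul_sum, sum_add_distrib, sum_add_distrib, ← mul_sum, sum_add_distrib, ← mul_sum,
          ← sum_filter, ← sum_filter, sum_const, sum_const, nsmul_eq_mul, nsmul_eq_mul]
    _ ≤ 2 * √(Int.gcd q a₂) * √q *
        (2 * q * (2 * (1 + Real.log q) + (1 + Real.log q))
          + (2 * q * ρ + 2 + 1) * B + (2 * q * ρ + 1) * B) := by
        gcongr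
        · exact sum_range_inv_le q
        · exact sum_range_inv_sub_le q
        · exact card_filter_range_lt_le q (by positivity)
        · exact card_filter_range_sub_lt_le q (by positivity)
    _ = _ := by field_simp; ring

/-! ### The approximation for small `β₂` -/

/-- If the slopes `β₁ + 2 β u` stay below `1 / q`, then after Fourier inversion modulo `q` only the
frequency `j = 0` can resonate; it produces the main term. -/
lemma norm_quadSum_sub_main_le {q : ℕ} (hq : 1 ≤ q) (N : ℕ) (a₁ a₂ : ℤ) {β₁ β : ℝ}
    (hβ₁ : |β₁| ≤ 1 / (2 * q)) (hβ : 16 * q * |β| ≤ 1) (hN : 16 * q * |β| * N ≤ 1) :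
    ‖quadSum N (a₁ / q + β₁) (a₂ / q + β) - (q : ℂ)⁻¹ * S q a₁ a₂ * I N β₁ β‖ ≤
      2 * √(Int.gcd q a₂) * √q * (8 * (1 + Real.log q) + 140 / q) := by
  have : NeZero q := ⟨by omega⟩
  have hq1 : (1 : ℝ) ≤ q := by exact_mod_cast hq
  have hq0 : (0 : ℝ) < q := by linarith
  have hqβ₁ : q * |β₁| ≤ 1 / 2 := by
    calc q * |β₁| ≤ q * (1 / (2 * q)) := by gcongr
      _ = 1 / 2 := by field_simp
  have hT : ∀ j ∈ range q,
      ‖S q (a₁ + j) a₂ * quadSum N (a₁ / q + β₁ - ((a₁ + j : ℤ) : ℝ) / q) β -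
        (if j = 0 then S q a₁ a₂ * I N β₁ β else 0)‖ ≤
      2 * √(Int.gcd q a₂) * √q *
        (4 * q * ((j : ℝ)⁻¹ + ((q : ℝ) - j)⁻¹) + if j = 0 then 140 else 0) := by
    intro j hj
    have hjq : (j : ℝ) + 1 ≤ q := by exact_mod_cast mem_range.1 hj
    have hqj : 0 < (q : ℝ) - j := by linarith
    have hγ : a₁ / q + β₁ - ((a₁ + j : ℤ) : ℝ) / q = β₁ - j / q := by push_cast; ring
    rw [hγ]
    rcases eq_or_ne j 0 with rfl | hj0
    · have h1 : |β₁| ≤ q * |β₁| := le_mul_of_one_le_left (abs_nonneg _) hq1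
      have h2 : |β| ≤ q * |β| := le_mul_of_one_le_left (abs_nonneg _) hq1
      have h3 : |β| * N ≤ q * |β| * N := by gcongr
      have h4 := norm_quadSum_sub_I_le N β₁ β (by linarith)
      simp only [if_true, Nat.cast_zero, add_zero, zero_div, sub_zero]
      rw [← mul_sub, norm_mul]
      refine mul_le_mul (norm_S_le hq _ _) (h4.trans ?_) (norm_nonneg _) (by positivity)
      have : 0 ≤ 4 * q * ((0 : ℝ)⁻¹ + (q : ℝ)⁻¹) := by positivity
      linarith
    rw [if_neg hj0, if_neg hj0, sub_zero, add_zero, norm_mul]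
    refine mul_le_mul (norm_S_le hq _ _) ?_ (norm_nonneg _) (by positivity)
    have hj1 : (1 : ℝ) ≤ j := by exact_mod_cast Nat.one_le_iff_ne_zero.2 hj0
    set μ := min (j : ℝ) ((q : ℝ) - j) with hμ
    have hμ0 : 0 < μ := lt_min (by linarith) hqj
    have hμ1 : μ ≤ j := min_le_left _ _
    have hμ2 : μ ≤ q - j := min_le_right _ _
    refine (norm_quadSum_le_one_div N _ β (-1) (δ := μ / (4 * q)) (by positivity)
      fun n hn => ?_).trans (one_div_min_div_le (by linarith) hqj (by positivity))
    have hn1 : (n : ℝ) + 1 ≤ N := by exact_mod_cast hn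
    have hd : |q * (β₁ + β * (2 * n + 1))| ≤ 5 / 8 := by
      have h1 := abs_add_le β₁ (β * (2 * n + 1))
      rw [abs_mul β, abs_of_nonneg (by positivity : (0 : ℝ) ≤ 2 * n + 1)] at h1
      have h2 : q * (|β| * (2 * n + 1)) ≤ q * (|β| * (2 * N)) := by gcongr; linarith
      have h3 := mul_le_mul_of_nonneg_left h1 hq0.le
      rw [abs_mul, abs_of_pos hq0]
      linarith
    obtain ⟨hd1, hd2⟩ := abs_le.1 hd
    have hq2 : μ / (4 * q) = μ / 4 / q := by field_simp
    have hform : β₁ - j / q + β * (2 * n + 1) = (q * (β₁ + β * (2 * n + 1)) - j) / q := by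
      field_simp; ring
    rw [hform, hq2]
    push_cast
    constructor
    · rw [← sub_nonneg, show ∀ x : ℝ, x / q - (-1 + μ / 4 / q) = (x + q - μ / 4) / q by
        intro x; field_simp; ring]
      refine div_nonneg ?_ hq0.le
      linarith
    · rw [← sub_nonneg, show ∀ x : ℝ, (-1 + 1 - μ / 4 / q) - x / q = (- μ / 4 - x) / q by
        intro x; field_simp; ring]
      refine div_nonneg ?_ hq0.le
      linarith
  have hsplit : quadSum N (a₁ / q + β₁) (a₂ / q + β) - (q : ℂ)⁻¹ * S q a₁ a₂ * I N β₁ β =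
      (q : ℂ)⁻¹ * ∑ j ∈ range q,
        (S q (a₁ + j) a₂ * quadSum N (a₁ / q + β₁ - ((a₁ + j : ℤ) : ℝ) / q) β -
          (if j = 0 then S q a₁ a₂ * I N β₁ β else 0)) := by
    rw [quadSum_eq_sum_S_mul N _ β a₂ a₁, sum_sub_distrib, sum_ite_eq' (range q) 0,
      if_pos (mem_range.2 (by omega))]
    ring
  refine norm_inv_mul_le hq ?_ hsplit
  calc _ ≤ _ := (norm_sum_le _ _).trans (sum_le_sum hT)
    _ = 2 * √(Int.gcd q a₂) * √q *
        (4 * q * (∑ j ∈ range q, (j : ℝ)⁻¹ + ∑ j ∈ range q, ((q : ℝ) - j)⁻¹) + 140) := by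
        rw [← mul_sum, sum_add_distrib, ← mul_sum, sum_add_distrib, sum_ite_eq' (range q) 0,
          if_pos (mem_range.2 (by omega))]
    _ ≤ 2 * √(Int.gcd q a₂) * √q *
        (4 * q * ((1 + Real.log q) + (1 + Real.log q)) + 140) := by
        gcongr
        · exact sum_range_inv_le q
        · exact sum_range_inv_sub_le q
    _ = _ := by field_simp; ring

/-! ### Passing from `quadSum` and integer length to `f` and real length -/

lemma norm_f_sub_quadSum_le (X α₁ α₂ : ℝ) : ‖f X α₁ α₂ - quadSum ⌊X⌋₊ α₁ α₂‖ ≤ 2 := by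
  set F : ℕ → ℂ := fun n => e (α₁ * n + α₂ * (n : ℝ) ^ 2) with hF
  have h : f X α₁ α₂ - quadSum ⌊X⌋₊ α₁ α₂ = F ⌊X⌋₊ - F 0 := by
    have hIcc : Icc 1 ⌊X⌋₊ = Ico 1 (⌊X⌋₊ + 1) := by ext; simp
    have h1 := sum_range_succ F ⌊X⌋₊
    rw [sum_range_succ'] at h1
    rw [f, quadSum, hIcc, sum_Ico_eq_sum_range, Nat.add_sub_cancel, sub_eq_sub_iff_add_eq_add,
      add_comm (F _), ← h1]
    congr 1
    exact sum_congr rfl fun n _ => by rw [add_comm 1 n]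
  rw [h]
  refine (norm_sub_le _ _).trans ?_
  simp only [hF, norm_e]
  norm_num

lemma norm_I_sub_I_floor_le {X : ℝ} (hX : 0 ≤ X) (γ β : ℝ) :
    ‖I X γ β - I ⌊X⌋₊ γ β‖ ≤ 1 := by
  unfold I
  rw [intervalIntegral.integral_interval_sub_left (intervalIntegrable_e_comp (by fun_prop) _ _)
    (intervalIntegrable_e_comp (by fun_prop) _ _)]
  refine (intervalIntegral.norm_integral_le_of_norm_le_const (C := 1)
    fun s _ => (norm_e _).le).trans ?_
  rw [one_mul, abs_of_nonneg (sub_nonneg.2 (Nat.floor_le hX))]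
  linarith [Nat.lt_floor_add_one X]

/-! ### Upper bounds when `β₂` is not small -/

lemma norm_S_le_self (q : ℕ) (a₁ a₂ : ℤ) : ‖S q a₁ a₂‖ ≤ q := by
  unfold S
  refine (norm_sum_le _ _).trans ?_
  simp [norm_e]

/-- The bound for the sum when `β X` is at least of order `1 / q`: the term `1 / √|β|` of the bound
for short sums is then absorbed, and a long sum is cut into pieces of length about
`1 / (8 |β|)`. -/
lemma norm_quadSum_le_mul_sqrt {q : ℕ} (hq : 1 ≤ q) (N : ℕ) {X : ℝ} (hNX : N ≤ X) (α₁ : ℝ)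
    (a₂ : ℤ) {β : ℝ} (hβ : 16 * q * |β| ≤ 1) (hX : 1 ≤ 16 * q * |β| * X) :
    ‖quadSum N α₁ (a₂ / q + β)‖ ≤
      √(Int.gcd q a₂) * √q * (24 * (1 + Real.log q) + 1200 * (1 + Real.log q) * (√|β| * X)) := by
  have hq1 : (1 : ℝ) ≤ q := by exact_mod_cast hq
  have hX0 : 0 ≤ X := (Nat.cast_nonneg N).trans hNX
  have hβ0 : β ≠ 0 := by rintro rfl; norm_num at hX
  set t := √|β| with ht
  have ht0 : 0 < t := Real.sqrt_pos.2 (abs_pos.2 hβ0)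
  have htt : |β| = t * t := (Real.mul_self_sqrt (abs_nonneg _)).symm
  have hβ1 : |β| ≤ 1 / 16 := by
    have := le_mul_of_one_le_left (abs_nonneg β) hq1
    linarith
  set l := 1 + Real.log q with hl
  have hl1 : 1 ≤ l := by linarith [Real.log_nonneg hq1]
  set G := √(Int.gcd q a₂ : ℝ) * √q with hG
  have hG0 : 0 ≤ G := by positivity
  have htX : 0 ≤ t * X := by positivity
  -- A common form of the bound for short sums.
  have hshort : ∀ n : ℕ, n * |β| ≤ 1 / 8 → ∀ γ, ‖quadSum n γ (a₂ / q + β)‖ ≤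
      G * (12 * l + 32 * (n * t) + 32 * (1 / (q * t))) := fun n hn γ => by
    refine (norm_quadSum_le_of_short hq n γ a₂ hβ0 hβ1 hn).trans_eq ?_
    rw [← ht, ← hl, htt, hG]
    have : (q : ℝ) ≠ 0 := by positivity
    field_simp
    ring
  have hqt : 1 / (q * t) ≤ 16 * (t * X) := by
    rw [div_le_iff₀ (by positivity)]
    calc 1 ≤ 16 * q * |β| * X := hX
      _ = _ := by rw [htt]; ring
  rcases le_total (N * |β|) (1 / 8) with hN | hN
  · refine (hshort N hN α₁).trans ?_
    have h1 : N * t ≤ t * X := by rw [mul_comm]; gcongr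
    have h2 : t * X ≤ l * (t * X) := le_mul_of_one_le_left htX hl1
    exact mul_le_mul_of_nonneg_left (by linarith) hG0
  · set L := ⌊1 / (8 * |β|)⌋₊ with hL
    have hβpos : 0 < |β| := abs_pos.2 hβ0
    have hLβ : L * |β| ≤ 1 / 8 := by
      have := Nat.floor_le (by positivity : 0 ≤ 1 / (8 * |β|))
      calc L * |β| ≤ 1 / (8 * |β|) * |β| := by gcongr
        _ = 1 / 8 := by field_simp
    have hLβ' : 1 / 16 ≤ L * |β| := by
      have h1 : 1 / (8 * |β|) - 1 ≤ L := (Nat.sub_one_lt_floor _).le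
      have h2 : (1 / (8 * |β|) - 1) * |β| ≤ L * |β| := by gcongr
      rw [sub_mul, show 1 / (8 * |β|) * |β| = 1 / 8 by field_simp] at h2
      linarith
    have hL0 : 0 < L := by
      rcases Nat.eq_zero_or_pos L with h | h
      · rw [h] at hLβ'; norm_num at hLβ'
      · exact h
    have hL0' : (0 : ℝ) < L := by exact_mod_cast hL0
    have ht1 : t ≤ 1 / 4 := by nlinarith
    have hblock : ∀ n ≤ L, ∀ γ, ‖quadSum n γ (a₂ / q + β)‖ ≤ G * (39 * l / t) := by
      intro n hn γ
      have hn' : (n : ℝ) * |β| ≤ 1 / 8 := le_trans (by gcongr) hLβ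
      refine (hshort n hn' γ).trans (mul_le_mul_of_nonneg_left ?_ hG0)
      have h1 : 1 / (q * t) ≤ 1 / t :=
        one_div_le_one_div_of_le ht0 (le_mul_of_one_le_left ht0.le hq1)
      have h2 : n * t ≤ 1 / 8 / t := by
        rw [le_div_iff₀ ht0, mul_assoc, ← htt]
        exact hn'
      have h3 : l ≤ l / 4 / t := by
        rw [le_div_iff₀ ht0]
        nlinarith
      have h4 : 1 / t ≤ l / t := by gcongr
      rw [show 39 * l / t = 39 * (l / t) by ring]
      rw [show 1 / 8 / t = 1 / 8 * (1 / t) by ring] at h2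
      rw [show l / 4 / t = 1 / 4 * (l / t) by ring] at h3
      linarith
    have hcount : (N : ℝ) / L + 1 ≤ 24 * (N * |β|) := by
      have h1 : (N : ℝ) / L ≤ 16 * (N * |β|) := by
        rw [div_le_iff₀ hL0']
        calc (N : ℝ) = 16 * N * (1 / 16) := by ring
          _ ≤ 16 * N * (L * |β|) := by gcongr
          _ = _ := by ring
      linarith
    calc ‖quadSum N α₁ (a₂ / q + β)‖ ≤ (N / L + 1) * (G * (39 * l / t)) :=
          norm_quadSum_le_of_blocks hL0 hblock N α₁
      _ ≤ 24 * (N * |β|) * (G * (39 * l / t)) := by gcongr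
      _ = G * (936 * l * (t * N)) := by rw [htt]; field_simp; ring
      _ ≤ G * (24 * l + 1200 * l * (t * X)) := by
          have h1 : l * (t * N) ≤ l * (t * X) := by gcongr
          have h2 : 0 ≤ l * (t * X) := by positivity
          exact mul_le_mul_of_nonneg_left (by linarith) hG0

end QuadWeyl

/-! ### The approximation for arbitrary `β₂` -/

open QuadWeyl in
theorem theorem2p1 :
    ∃ C : ℝ, 0 < C ∧
      ∀ (X : ℝ) (q : ℕ) (a₁ a₂ : ℤ) (α₁ α₂ β₁ β₂ : ℝ),
        0 ≤ X → 1 ≤ q →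
        β₁ = α₁ - (a₁ : ℝ) / (q : ℝ) →
        β₂ = α₂ - (a₂ : ℝ) / (q : ℝ) →
        |β₁| ≤ 1 / (2 * (q : ℝ)) →
        ‖QuadWeyl.f X α₁ α₂ - (q : ℂ)⁻¹ * QuadWeyl.S q a₁ a₂ * QuadWeyl.I X β₁ β₂‖ ≤
          C * (Real.sqrt (Int.gcd (q : ℤ) a₂ : ℝ) *
            Real.sqrt ((q : ℝ) + (q : ℝ) * X ^ 2 * |β₂|) * Real.log (2 * (q : ℝ))) := by
  refine ⟨4000, by norm_num, ?_⟩
  intro X q a₁ a₂ α₁ α₂ β₁ β₂ hX hq hβ₁ hβ₂ hβ₁q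
  obtain rfl : α₁ = a₁ / q + β₁ := by linarith
  obtain rfl : α₂ = a₂ / q + β₂ := by linarith
  clear hβ₁ hβ₂
  have hq1 : (1 : ℝ) ≤ q := by exact_mod_cast hq
  have hq0 : (0 : ℝ) < q := by linarith
  set N := ⌊X⌋₊ with hN
  have hNX : (N : ℝ) ≤ X := Nat.floor_le hX
  have hd : (1 : ℝ) ≤ √(Int.gcd q a₂ : ℝ) := by
    rw [Real.one_le_sqrt]
    have : Int.gcd q a₂ ≠ 0 := by rw [Ne, Int.gcd_eq_zero_iff]; omega
    exact_mod_cast Nat.one_le_iff_ne_zero.2 this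
  set D := √(Int.gcd q a₂ : ℝ) with hD
  set Y := √((q : ℝ) + q * X ^ 2 * |β₂|) with hY
  set L := Real.log (2 * q) with hL
  have hqY : √q ≤ Y := Real.sqrt_le_sqrt (le_add_of_nonneg_right (by positivity))
  have hXY : √q * (√|β₂| * X) ≤ Y := by
    refine Real.le_sqrt_of_sq_le ?_
    rw [mul_pow, mul_pow, Real.sq_sqrt hq0.le, Real.sq_sqrt (abs_nonneg _)]
    linarith
  have hq1' : 1 ≤ √(q : ℝ) := Real.one_le_sqrt.2 hq1
  have hlog : L = Real.log 2 + Real.log q := Real.log_mul two_ne_zero hq0.ne'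
  have hlog2 := Real.log_two_gt_d9
  have hlogq := Real.log_nonneg hq1
  have hL1 : 1 + Real.log q ≤ 2 * L := by linarith
  have hL2 : 1 ≤ 2 * L := by linarith
  have hY1 : 1 ≤ Y := hq1'.trans hqY
  have hDY : 1 ≤ D * Y := one_le_mul_of_one_le_of_one_le hd hY1
  have hDYL : D * Y ≤ 2 * (D * Y * L) := by nlinarith
  have hDqY : D * √q ≤ D * Y := by gcongr
  have hqinv : ‖(q : ℂ)⁻¹‖ = (q : ℝ)⁻¹ := by rw [norm_inv, Complex.norm_natCast]
  have hfN := norm_f_sub_quadSum_le X (a₁ / q + β₁) (a₂ / q + β₂)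
  rw [← hN] at hfN
  rcases lt_or_ge 1 (16 * q * |β₂|) with hbig | hsmall
  · -- Both terms are at most `X`, and so is a multiple of the bound.
    have hf : ‖f X (a₁ / q + β₁) (a₂ / q + β₂)‖ ≤ X := by
      unfold f
      refine (norm_sum_le _ _).trans ?_
      simpa [norm_e] using hNX
    have hm : ‖(q : ℂ)⁻¹ * S q a₁ a₂ * I X β₁ β₂‖ ≤ X := by
      rw [norm_mul, norm_mul, hqinv]
      calc _ ≤ (q : ℝ)⁻¹ * q * X := by
            gcongr
            · exact norm_S_le_self q a₁ a₂
            · exact norm_I_le hX β₁ β₂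
        _ = X := by field_simp
    have hXY' : X / 4 ≤ Y := by
      refine Real.le_sqrt_of_sq_le ?_
      have : 0 ≤ X ^ 2 * (16 * q * |β₂| - 1) := mul_nonneg (sq_nonneg X) (by linarith)
      nlinarith
    have hYD : Y ≤ D * Y := le_mul_of_one_le_left (by linarith) hd
    refine (norm_sub_le _ _).trans ?_
    linarith
  rcases le_or_gt (16 * q * |β₂| * X) 1 with hA | hB
  · -- The slopes `β₁ + 2 β₂ u` are less than `1 / q`, and the main term is extracted.
    have hNβ : 16 * q * |β₂| * N ≤ 1 := le_trans (by gcongr) hA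
    have h1 := norm_quadSum_sub_main_le hq N a₁ a₂ hβ₁q hsmall hNβ
    have hs := norm_S_le hq a₁ a₂
    rw [← hD] at h1 hs
    have h2 : ‖(q : ℂ)⁻¹ * S q a₁ a₂ * (I N β₁ β₂ - I X β₁ β₂)‖ ≤ 2 * D * √q := by
      rw [norm_mul, norm_mul, hqinv, norm_sub_rev (I N β₁ β₂)]
      calc _ ≤ 1 * (2 * D * √q) * 1 := by
            gcongr
            · exact inv_le_one_of_one_le₀ hq1
            · exact norm_I_sub_I_floor_le hX β₁ β₂
        _ = _ := by ring
    have h3 : 2 * D * √q * (8 * (1 + Real.log q) + 140 / q) ≤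
        2 * (D * Y) * (8 * (2 * L) + 140 * (2 * L)) := by
      rw [mul_assoc 2 D]
      gcongr
      exact (div_le_self (by norm_num) hq1).trans (by linarith)
    have hsplit : f X (a₁ / q + β₁) (a₂ / q + β₂) - (q : ℂ)⁻¹ * S q a₁ a₂ * I X β₁ β₂ =
        (f X (a₁ / q + β₁) (a₂ / q + β₂) - quadSum N (a₁ / q + β₁) (a₂ / q + β₂)) +
        (quadSum N (a₁ / q + β₁) (a₂ / q + β₂) - (q : ℂ)⁻¹ * S q a₁ a₂ * I N β₁ β₂) +
        (q : ℂ)⁻¹ * S q a₁ a₂ * (I N β₁ β₂ - I X β₁ β₂) := by ring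
    rw [hsplit]
    refine norm_add₃_le.trans ?_
    linarith
  · -- Sum and main term are bounded separately, since `1 / √|β₂| ≤ 16 q X √|β₂|`.
    have hβ0 : β₂ ≠ 0 := by rintro rfl; norm_num at hB
    have h1 := norm_quadSum_le_mul_sqrt hq N hNX (a₁ / q + β₁) a₂ hsmall hB.le
    rw [← hD] at h1
    set t := √|β₂| with ht
    have ht0 : 0 < t := Real.sqrt_pos.2 (abs_pos.2 hβ0)
    have htt : |β₂| = t * t := (Real.mul_self_sqrt (abs_nonneg _)).symm
    have hm : ‖(q : ℂ)⁻¹ * S q a₁ a₂ * I X β₁ β₂‖ ≤ 160 * (D * Y) := by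
      have hI : ‖I X β₁ β₂‖ ≤ 80 * (q * (t * X)) := by
        refine (norm_I_le_div_sqrt hX β₁ hβ0).trans ?_
        rw [← ht, div_le_iff₀ ht0]
        calc (5 : ℝ) ≤ 5 * (16 * q * |β₂| * X) := by linarith
          _ = _ := by rw [htt]; ring
      rw [norm_mul, norm_mul, hqinv]
      calc _ ≤ (q : ℝ)⁻¹ * (2 * D * √q) * (80 * (q * (t * X))) := by
            gcongr
            exact norm_S_le hq a₁ a₂
        _ = 160 * (D * (√q * (t * X))) := by field_simp; ring
        _ ≤ 160 * (D * Y) := by gcongr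
    have h2 : D * √q * (24 * (1 + Real.log q) + 1200 * (1 + Real.log q) * (t * X)) ≤
        24 * (2 * L) * (D * Y) + 1200 * (2 * L) * (D * Y) := by
      calc _ = 24 * (1 + Real.log q) * (D * √q)
            + 1200 * (1 + Real.log q) * (D * (√q * (t * X))) := by ring
        _ ≤ _ := by gcongr
    have hsplit : f X (a₁ / q + β₁) (a₂ / q + β₂) - (q : ℂ)⁻¹ * S q a₁ a₂ * I X β₁ β₂ =
        (f X (a₁ / q + β₁) (a₂ / q + β₂) - quadSum N (a₁ / q + β₁) (a₂ / q + β₂)) +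
        quadSum N (a₁ / q + β₁) (a₂ / q + β₂) + -((q : ℂ)⁻¹ * S q a₁ a₂ * I X β₁ β₂) := by ring
    rw [hsplit]
    refine norm_add₃_le.trans ?_
    rw [norm_neg]
    linarith
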